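/- Let $G=(V,E)$ be a finite graph and $k$ a natural number. An (oriented) separation of $G$ is a pair $(A,B)$ with $A\cup B=V$ and no edge of $G$ between $A\setminus B$ and $B\setminus A$. Its inverse is $(A,B)^*=(B,A)$, its order is $|A\cap B|$, and $(A,B)\le(C,D)$ means $A\subseteq C$ and $B\supseteq D$. It is degenerate if it equals its inverse. Let $\vec S_k$ be the set of all separations of order less than $k$. A separation $r$ is trivial in $\vec S_k$ if there is an $s\in\vec S_k$ with $r<s$ and $r<s^*$. An orientation of $\vec S_k$ is a subset of $\vec S_k$ that contains, for every $s\in\vec S_k$, exactly one element of $\{s,s^*\}$. It is consistent if it never contains both $r^*$ and $s$ when $r<s$ and $\{r,r^*\}\ne\{s,s^*\}$. Let $\mathcal T_k$ be the family of all sets $\{(A_1,B_1),(A_2,B_2),(A_3,B_3)\}\subseteq\vec S_k$ (the three separations need not be distinct) such that $G[A_1]\cup G[A_2]\cup G[A_3]=G$. A $k$-tangle of $G$ is a consistent orientation of $\vec S_k$ that has no member of $\mathcal T_k$ as a subset. A star is a set of non-degenerate separations such that $r\le s^*$ for all distinct elements $r,s$ of it, and $\mathcal T_k^*$ is the family of the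 stars in $\mathcal T_k$. For a family $\mathcal F$ of subsets of $\vec S_k$, an $S_k$-tree over $\mathcal F$ is a finite tree $T$ with at least one edge together with a map $\alpha$ from the set of oriented edges $(t,t')$ of $T$ to $\vec S_k$ such that $\alpha(t',t)=\alpha(t,t')^*$ for every oriented edge $(t,t')$, and $\{\alpha(t',t): tt'\in E(T)\}\in\mathcal F$ for every vertex $t$ of $T$. Lemma. Let $O$ be a $k$-tangle of $G$, and let $x\in\vec S_k$ be a maximal element of $O$ (with respect to $\le$) that is inessential, i.e. lies in every $k$-tangle of $G$, and that is not trivial in $\vec S_k$. Then there is an $S_k$-tree over $\mathcal T_k^*\cup\{\{x\}\}$. -/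

import Mathlib

universe u

/-- An oriented separation `(A, B)` of a graph `G`: `A ∪ B = V(G)` and there is no edge of `G`
between `A \ B` and `B \ A`. It points towards `right = B` and away from `left = A`. -/
@[ext]
structure OrientedSep {V : Type u} (G : SimpleGraph V) where
  left : Set V
  right : Set V
  union_eq : left ∪ right = Set.univ
  no_edge : ∀ a ∈ left \ right, ∀ b ∈ right \ left, ¬ G.Adj a b

namespace OrientedSep

variable {V : Type u} {G : SimpleGraph V}

/-- The inverse `(B, A)` of an oriented separation `(A, B)`. -/
def inv (s : OrientedSep G) : OrientedSep G where
  left := s.right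
  right := s.left
  union_eq := by rw [Set.union_comm]; exact s.union_eq
  no_edge := fun a ha b hb h => s.no_edge b hb a ha h.symm

/-- `(A, B) ≤ (C, D)` if and only if `A ⊆ C` and `B ⊇ D`. -/
instance : PartialOrder (OrientedSep G) where
  le r s := r.left ⊆ s.left ∧ s.right ⊆ r.right
  le_refl _ := ⟨subset_rfl, subset_rfl⟩
  le_trans _ _ _ h₁ h₂ := ⟨h₁.1.trans h₂.1, h₂.2.trans h₁.2⟩
  le_antisymm _ _ h₁ h₂ :=
    OrientedSep.ext (h₁.1.antisymm h₂.1) (h₂.2.antisymm h₁.2)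

/-- The order `|A ∩ B|` of a separation of a finite graph. -/
noncomputable def ord (s : OrientedSep G) : ℕ := (s.left ∩ s.right).ncard

/-- A set `S` of oriented separations contains an `s` such that `r < s` and `r < s*`. -/
def IsTrivialIn (S : Set (OrientedSep G)) (r : OrientedSep G) : Prop :=
  ∃ s ∈ S, r < s ∧ r < s.inv

/-- `O` is an orientation of `S`: a subset of `S` which contains, for each separation in `S`,
exactly one of its orientations. -/
def IsOrientation (S O : Set (OrientedSep G)) : Prop :=
  O ⊆ S ∧ ∀ s ∈ S, ∃! r, r ∈ O ∧ (r = s ∨ r = s.inv)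

/-- `O` is consistent: if `r < s` are orientations of two distinct (unoriented) separations,
then `O` does not contain both `r*` and `s`. -/
def IsConsistent (O : Set (OrientedSep G)) : Prop :=
  ∀ r s : OrientedSep G, r ≠ s → r ≠ s.inv → r < s → ¬ (r.inv ∈ O ∧ s ∈ O)

/-- An `F`-tangle of `S`: a consistent orientation of `S` that has no member of `F` as a subset. -/
def IsTangleOf (S : Set (OrientedSep G)) (F : Set (Set (OrientedSep G)))
    (O : Set (OrientedSep G)) : Prop :=
  IsOrientation S O ∧ IsConsistent O ∧ ∀ σ ∈ F, ¬ σ ⊆ O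

/-- A star: a set of non-degenerate oriented separations such that `r ≤ s*` for all distinct
`r` and `s` in it. -/
def IsStar (σ : Set (OrientedSep G)) : Prop :=
  (∀ s ∈ σ, s ≠ s.inv) ∧ ∀ r ∈ σ, ∀ s ∈ σ, r ≠ s → r ≤ s.inv

/-- An `S`-tree over `F`: a tree `T` with at least one edge, together with a map `α` from the
oriented edges of `T` to `S` which commutes with inversion and which, for every vertex `t`, sends
the edges oriented towards `t` onto a member of `F`. -/
structure IsSTree (S : Set (OrientedSep G)) (F : Set (Set (OrientedSep G)))
    {W : Type*} (T : SimpleGraph W) (α : T.Dart → OrientedSep G) : Prop where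
  isTree : T.IsTree
  exists_edge : ∃ t t', T.Adj t t'
  mem : ∀ e, α e ∈ S
  map_symm : ∀ e : T.Dart, α e.symm = (α e).inv
  star_mem : ∀ t : W, α '' {e | e.snd = t} ∈ F

variable (G)

/-- The set of oriented separations of `G` of order less than `k`. -/
def sepsLT (k : ℕ) : Set (OrientedSep G) := {s | s.ord < k}

/-- The sets of three (not necessarily distinct) separations `(Aᵢ, Bᵢ)` of order less than `k`
such that `G` is the union of the induced subgraphs `G[A₁]`, `G[A₂]`, `G[A₃]`. -/
def coverTriples (k : ℕ) : Set (Set (OrientedSep G)) :=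
  {σ | ∃ r₁ ∈ sepsLT G k, ∃ r₂ ∈ sepsLT G k, ∃ r₃ ∈ sepsLT G k, σ = {r₁, r₂, r₃} ∧
    (⊤ : G.Subgraph).induce r₁.left ⊔ (⊤ : G.Subgraph).induce r₂.left ⊔
      (⊤ : G.Subgraph).induce r₃.left = ⊤}

/-- The stars among the covering triples. -/
def coverStars (k : ℕ) : Set (Set (OrientedSep G)) :=
  {σ | σ ∈ coverTriples G k ∧ IsStar σ}

/-- A `k`-tangle of `G`: a consistent orientation of the separations of order less than `k` in
which no three small sides cover `G`. -/
def IsTangle (k : ℕ) (O : Set (OrientedSep G)) : Prop :=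
  IsTangleOf (sepsLT G k) (coverTriples G k) O

/-- A separation of order less than `k` is inessential if it lies in every `k`-tangle of `G`. -/
def IsInessential (k : ℕ) (x : OrientedSep G) : Prop :=
  x ∈ sepsLT G k ∧ ∀ P : Set (OrientedSep G), IsTangle G k P → x ∈ P

/-- The maximal elements of `O` that are inessential. -/
def maxInessential (k : ℕ) (O : Set (OrientedSep G)) : Set (OrientedSep G) :=
  {x | Maximal (fun y => y ∈ O) x ∧ IsInessential G k x}

end OrientedSep

/-! `Derivable` encodes rooted trees over the covering stars whose remaining leaves are `{p*}` with
`p ∈ P`. Let `P` be the separations of order `< k` below `x*`. If nothing were derivable in both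
orientations, a maximal down-closed unforced extension of `P` would be a `k`-tangle containing `x*`
(`exists_isTangle_of_unforced`), although `x` is inessential. Such a set orients everything, since
opposing derivations can be shifted onto one separation of minimum order between them
(`Derivable.shift`); it avoids covering triples, since these uncross to stars
(`exists_coverStar_subset`).

So some `t` is derivable both ways. Following `O` through the resulting tree leads to a leaf, which
maximality of `x` forces to be `x*`. Leaves off this path lie below both `x` and `x*`, so they are
small and form covering stars by themselves (`exists_derivable_pair`). Gluing the two derivations
gives the tree (`exists_isSTree`). -/

namespace OrientedSep

/-! ### Corners, submodularity and covering triples -/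

section Basic

variable {V : Type u} {G : SimpleGraph V}

@[simp] lemma inv_left (s : OrientedSep G) : s.inv.left = s.right := rfl

@[simp] lemma inv_right (s : OrientedSep G) : s.inv.right = s.left := rfl

@[simp] lemma inv_inv (s : OrientedSep G) : s.inv.inv = s := rfl

lemma inv_injective : Function.Injective (inv : OrientedSep G → OrientedSep G) :=
  fun r s h => by rw [← inv_inv r, h, inv_inv]

lemma inv_le_inv {r s : OrientedSep G} : r.inv ≤ s.inv ↔ s ≤ r :=
  ⟨fun h => ⟨h.2, h.1⟩, fun h => ⟨h.2, h.1⟩⟩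

lemma le_inv_comm {r s : OrientedSep G} : r ≤ s.inv ↔ s ≤ r.inv :=
  ⟨fun h => ⟨h.2, h.1⟩, fun h => ⟨h.2, h.1⟩⟩

lemma inv_le_comm {r s : OrientedSep G} : r.inv ≤ s ↔ s.inv ≤ r :=
  ⟨fun h => ⟨h.2, h.1⟩, fun h => ⟨h.2, h.1⟩⟩

@[simp] lemma ord_inv (s : OrientedSep G) : s.inv.ord = s.ord := by
  simp [ord, Set.inter_comm]

lemma inv_mem_sepsLT {k : ℕ} {s : OrientedSep G} : s.inv ∈ sepsLT G k ↔ s ∈ sepsLT G k := by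
  simp [sepsLT]

lemma mem_union (s : OrientedSep G) (v : V) : v ∈ s.left ∨ v ∈ s.right := by
  have : v ∈ s.left ∪ s.right := s.union_eq ▸ Set.mem_univ v
  exact this

lemma adj_sides (s : OrientedSep G) {u v : V} (h : G.Adj u v) :
    (u ∈ s.left ∧ v ∈ s.left) ∨ (u ∈ s.right ∧ v ∈ s.right) := by
  have h₁ := s.no_edge u
  have h₂ := s.no_edge v
  have h₃ := s.mem_union u
  have h₄ := s.mem_union v
  by_contra hc
  have := h.symm
  simp only [Set.mem_sdiff] at h₁ h₂
  grind

/-- The infimum `(A ∩ C, B ∪ D)` of two separations `(A, B)` and `(C, D)`. -/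
def meet (r s : OrientedSep G) : OrientedSep G where
  left := r.left ∩ s.left
  right := r.right ∪ s.right
  union_eq := by
    ext v
    have h₁ := r.mem_union v
    have h₂ := s.mem_union v
    simp only [Set.mem_union, Set.mem_inter_iff, Set.mem_univ, iff_true]
    tauto
  no_edge := by
    intro a ha b hb hab
    have h₁ := r.adj_sides hab
    have h₂ := s.adj_sides hab
    simp only [Set.mem_sdiff, Set.mem_inter_iff, Set.mem_union] at ha hb
    tauto

lemma meet_le_left (r s : OrientedSep G) : r.meet s ≤ r :=
  ⟨Set.inter_subset_left, Set.subset_union_left⟩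

lemma meet_le_right (r s : OrientedSep G) : r.meet s ≤ s :=
  ⟨Set.inter_subset_right, Set.subset_union_right⟩

lemma le_meet {q r s : OrientedSep G} (h₁ : q ≤ r) (h₂ : q ≤ s) : q ≤ r.meet s :=
  ⟨Set.subset_inter h₁.1 h₂.1, Set.union_subset h₁.2 h₂.2⟩

lemma meet_eq_right {r s : OrientedSep G} (h : s ≤ r) : r.meet s = s :=
  le_antisymm (meet_le_right r s) (le_meet h le_rfl)

lemma meet_mono_left {q r : OrientedSep G} (h : q ≤ r) (s : OrientedSep G) :
    q.meet s ≤ r.meet s :=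
  le_meet ((meet_le_left q s).trans h) (meet_le_right q s)

/-- The order of separations is submodular. -/
lemma ord_meet_add_ord_meet_inv [Finite V] (r s : OrientedSep G) :
    (r.meet s).ord + (r.inv.meet s.inv).ord = r.ord + s.ord := by
  unfold ord meet
  simp only [inv_left, inv_right]
  rw [← Set.ncard_union_add_ncard_inter, ← Set.ncard_union_add_ncard_inter (r.left ∩ r.right)]
  congr 2 <;>
  · ext v
    have h₁ := r.mem_union v
    have h₂ := s.mem_union v
    simp only [Set.mem_union, Set.mem_inter_iff]
    tauto

lemma right_eq_univ_of_le {r s : OrientedSep G} (h₁ : r ≤ s) (h₂ : r ≤ s.inv) :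
    r.right = Set.univ :=
  Set.eq_univ_of_forall fun v => (s.mem_union v).elim (fun h => h₂.2 h) (fun h => h₁.2 h)

/-- The small sides of the family `r` cover `G`. -/
def Covers {ι : Type*} (r : ι → OrientedSep G) : Prop :=
  (∀ v, ∃ i, v ∈ (r i).left) ∧ ∀ u v, G.Adj u v → ∃ i, u ∈ (r i).left ∧ v ∈ (r i).left

/-- Indexing by `Fin 3` allows members to be replaced one by one even when some coincide. -/
lemma mem_coverTriples {k : ℕ} {σ : Set (OrientedSep G)} :
    σ ∈ coverTriples G k ↔
      ∃ r : Fin 3 → OrientedSep G, (∀ i, r i ∈ sepsLT G k) ∧ σ = Set.range r ∧ Covers r := by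
  have key (r₁ r₂ r₃ : OrientedSep G) :
      ((⊤ : G.Subgraph).induce r₁.left ⊔ (⊤ : G.Subgraph).induce r₂.left ⊔
        (⊤ : G.Subgraph).induce r₃.left = ⊤) ↔ Covers ![r₁, r₂, r₃] := by
    rw [SimpleGraph.Subgraph.ext_iff]
    simp only [SimpleGraph.Subgraph.verts_sup, SimpleGraph.Subgraph.induce_verts,
      SimpleGraph.Subgraph.verts_top, Set.eq_univ_iff_forall, funext_iff,
      SimpleGraph.Subgraph.sup_adj, SimpleGraph.Subgraph.induce_adj, SimpleGraph.Subgraph.top_adj,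
      Covers, Fin.exists_fin_succ, eq_iff_iff, Set.mem_union]
    simp
    grind
  constructor
  · rintro ⟨r₁, h₁, r₂, h₂, r₃, h₃, rfl, h⟩
    refine ⟨![r₁, r₂, r₃], ?_, ?_, (key _ _ _).1 h⟩
    · intro i
      fin_cases i <;> assumption
    · ext s
      simp only [Set.mem_insert_iff, Set.mem_singleton_iff, Set.mem_range, Fin.exists_fin_succ]
      simp [eq_comm]
  · rintro ⟨r, hr, rfl, h⟩
    refine ⟨r 0, hr 0, r 1, hr 1, r 2, hr 2, ?_, (key _ _ _).2 ?_⟩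
    · ext s
      simp [Fin.exists_fin_succ, eq_comm]
    · convert h
      ext i : 1
      fin_cases i <;> rfl

end Basic

/-! ### Derivations as rooted trees -/

section Derivation

variable {V : Type u} {G : SimpleGraph V}

/-- `Derivable F t`: there is a rooted tree over `F` with one dangling edge at its root, labelled
`t` in its orientation away from the root. -/
inductive Derivable (F : Set (Set (OrientedSep G))) : OrientedSep G → Prop
  | node (σ : Set (OrientedSep G)) (hσ : σ ∈ F) (t : OrientedSep G) (ht : t.inv ∈ σ)
      (h : ∀ r ∈ σ, r ≠ t.inv → Derivable F r) : Derivable F t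

/-- The stars in the covering triples together with a singleton star `{p*}` for every `p ∈ P`. -/
def starsWith (G : SimpleGraph V) (k : ℕ) (P : Set (OrientedSep G)) :
    Set (Set (OrientedSep G)) :=
  coverStars G k ∪ {σ | ∃ p ∈ P, σ = {p.inv}}

lemma derivable_of_mem {k : ℕ} {P : Set (OrientedSep G)} {p : OrientedSep G} (hp : p ∈ P) :
    Derivable (starsWith G k P) p :=
  .node {p.inv} (Or.inr ⟨p, hp, rfl⟩) p rfl (fun _ hr hne => absurd hr hne)

/-- Induction on derivations from `starsWith G k P`. -/
lemma Derivable.rec_stars {k : ℕ} {P : Set (OrientedSep G)} {M : OrientedSep G → Prop}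
    (hP : ∀ p ∈ P, M p)
    (hnode : ∀ σ ∈ coverStars G k, ∀ t, t.inv ∈ σ → t ∈ sepsLT G k →
      (∀ r ∈ σ, r ≠ t.inv → r ≤ t ∧ Derivable (starsWith G k P) r ∧ M r) → M t)
    {t : OrientedSep G} (h : Derivable (starsWith G k P) t) : M t := by
  induction h with
  | node σ hσ t ht h ih =>
    rcases hσ with hσ | ⟨p, hp, rfl⟩
    · refine hnode σ hσ t ht ?_ fun r hr hne => ⟨?_, h r hr hne, ih r hr hne⟩
      · obtain ⟨q, hq, rfl, -⟩ := mem_coverTriples.1 hσ.1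
        obtain ⟨i, hi⟩ := ht
        exact inv_mem_sepsLT.1 (hi ▸ hq i)
      · simpa using hσ.2.2 r hr _ ht hne
    · rw [inv_injective (Set.mem_singleton_iff.1 ht)]
      exact hP p hp

lemma Derivable.cut {k : ℕ} {P Q : Set (OrientedSep G)}
    (hP : ∀ p ∈ P, Derivable (starsWith G k Q) p) {t : OrientedSep G}
    (h : Derivable (starsWith G k P) t) : Derivable (starsWith G k Q) t :=
  h.rec_stars hP fun σ hσ t ht _ ih =>
    .node σ (Or.inl hσ) t ht fun r hr hne => (ih r hr hne).2.2

/-- In a graph with a `k`-tangle, a small separation is derivable. -/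
lemma derivable_of_small {k : ℕ} (hnd : ∀ s ∈ sepsLT G k, s ≠ s.inv) {P : Set (OrientedSep G)}
    {t : OrientedSep G} (ht : t ∈ sepsLT G k) (hs : t.right = Set.univ) :
    Derivable (starsWith G k P) t := by
  have ht' := inv_mem_sepsLT.2 ht
  refine .node {t.inv} (Or.inl ⟨mem_coverTriples.2 ⟨fun _ => t.inv, fun _ => ht', ?_, ?_, ?_⟩,
    ?_, ?_⟩) t rfl (fun _ hr hne => absurd hr hne)
  · simp
  · simp [hs]
  · simp [hs]
  · rintro s rfl
    exact hnd _ ht'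
  · rintro r rfl s rfl h
    exact absurd rfl h

end Derivation

end OrientedSep

namespace OrientedSep

/-! ### Removing or rerooting at an extra leaf -/

section Reroot

variable {V : Type u} {G : SimpleGraph V}

/-- A derivation that uses the additional leaf `s` derives a separation above `s`. -/
lemma Derivable.of_insert {k : ℕ} {P : Set (OrientedSep G)} {s t : OrientedSep G}
    (ht : Derivable (starsWith G k (insert s P)) t) :
    Derivable (starsWith G k P) t ∨ s ≤ t := by
  refine ht.rec_stars (M := fun t => Derivable (starsWith G k P) t ∨ s ≤ t) ?_ ?_
  · rintro p (rfl | hp)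
    · exact Or.inr le_rfl
    · exact Or.inl (derivable_of_mem hp)
  · intro σ hσ t htσ _ ih
    by_cases h : ∃ r ∈ σ, r ≠ t.inv ∧ s ≤ r
    · obtain ⟨r, hr, hne, hsr⟩ := h
      exact Or.inr (hsr.trans (ih r hr hne).1)
    · push Not at h
      exact Or.inl (.node σ (Or.inl hσ) t htσ fun r hr hne =>
        (ih r hr hne).2.2.resolve_right (h r hr hne))

/-- Rerooting a derivation at the additional leaf `s`. -/
lemma Derivable.reroot {k : ℕ} {P : Set (OrientedSep G)} {s t : OrientedSep G}
    (hs : s.right ≠ Set.univ) (ht : Derivable (starsWith G k (insert s P)) t)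
    (ht' : Derivable (starsWith G k P) t.inv) :
    Derivable (starsWith G k P) t ∨ Derivable (starsWith G k P) s.inv := by
  revert ht'
  refine ht.rec_stars (M := fun t => Derivable (starsWith G k P) t.inv →
    Derivable (starsWith G k P) t ∨ Derivable (starsWith G k P) s.inv) ?_ ?_
  · rintro p (rfl | hp) h
    · exact Or.inr h
    · exact Or.inl (derivable_of_mem hp)
  · intro σ hσ t htσ _ ih ht'
    by_cases h : ∃ r ∈ σ, r ≠ t.inv ∧ ¬ Derivable (starsWith G k P) r
    · obtain ⟨r, hr, hne, hnr⟩ := h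
      have hsr : s ≤ r := (ih r hr hne).2.1.of_insert.resolve_left hnr
      -- Only one branch needs `s`: otherwise `s ≤ q ≤ r*` and `s ≤ r` would make `s` small. So `σ`
      -- derives `r*` without `s`, and the descent continues along `r`.
      refine ((ih r hr hne).2.2 (.node σ (Or.inl hσ) _ hr fun q hq hqr => ?_)).imp_left
        fun h => absurd h hnr
      by_cases hqt : q = t.inv
      · exact hqt ▸ ht'
      · refine (ih q hq hqt).2.1.of_insert.resolve_right fun hsq => hs ?_
        exact right_eq_univ_of_le hsr (hsq.trans (hσ.2.2 q hq r hr hqr))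
    · push Not at h
      exact Or.inl (.node σ (Or.inl hσ) t htσ h)

/-- No separation is derivable in both orientations. -/
def Unforced (k : ℕ) (P : Set (OrientedSep G)) : Prop :=
  ∀ t, ¬ (Derivable (starsWith G k P) t ∧ Derivable (starsWith G k P) t.inv)

/-- A small `s` is already derivable, so adding it changes nothing. Otherwise exactly one of the two
derivations of a doubly derivable `t` needs `s`, and it is rerooted there. -/
lemma derivable_inv_of_not_unforced {k : ℕ} (hnd : ∀ s ∈ sepsLT G k, s ≠ s.inv)
    {P : Set (OrientedSep G)} {s : OrientedSep G} (hsk : s ∈ sepsLT G k) (hP : Unforced k P)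
    (h : ¬ Unforced k (insert s P)) : Derivable (starsWith G k P) s.inv := by
  unfold Unforced at h
  push Not at h
  obtain ⟨t, ht, ht'⟩ := h
  by_cases hs : s.right = Set.univ
  · have hcut : ∀ p ∈ insert s P, Derivable (starsWith G k P) p := by
      rintro p (rfl | hp)
      · exact derivable_of_small hnd hsk hs
      · exact derivable_of_mem hp
    exact absurd ⟨ht.cut hcut, ht'.cut hcut⟩ (hP t)
  · by_cases h₁ : Derivable (starsWith G k P) t
    · by_cases h₂ : Derivable (starsWith G k P) t.inv
      · exact absurd ⟨h₁, h₂⟩ (hP t)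
      · exact (ht'.reroot hs h₁).resolve_left h₂
    · by_cases h₂ : Derivable (starsWith G k P) t.inv
      · exact (ht.reroot hs h₂).resolve_left h₁
      · exact absurd (right_eq_univ_of_le (ht.of_insert.resolve_left h₁)
          (ht'.of_insert.resolve_left h₂)) hs

end Reroot

/-! ### Shifting derivations -/

section Shift

variable {V : Type u} [Finite V] {G : SimpleGraph V}

/-- Shifting a derivation of a separation `t ≤ s` to a separation `m ≤ s` of minimum order among
the separations between `m` and those that occur. -/
lemma Derivable.shift {k : ℕ} (hnd : ∀ s ∈ sepsLT G k, s ≠ s.inv) {P : Set (OrientedSep G)}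
    (hPk : P ⊆ sepsLT G k) (hP : ∀ r ∈ sepsLT G k, ∀ s ∈ P, r ≤ s → r ∈ P)
    {m s : OrientedSep G} (hm : ∀ q, m ≤ q → q ≤ s → m.ord ≤ q.ord) (hms : m ≤ s)
    {t : OrientedSep G} (ht : Derivable (starsWith G k P) t) (hts : t ≤ s) :
    Derivable (starsWith G k P) (t.meet m) := by
  have hord : ∀ t, t ≤ s → t ∈ sepsLT G k → t.meet m ∈ sepsLT G k := by
    intro t hts ht
    -- The supremum of `t` and `m` lies between `m` and `s`, so its order is at least `m.ord`; by
    -- submodularity the infimum has order at most `t.ord`.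
    have h₁ := ord_meet_add_ord_meet_inv t m
    have h₂ := hm (t.inv.meet m.inv).inv (le_inv_comm.1 (meet_le_right _ _))
      (inv_le_comm.1 (le_meet (inv_le_inv.2 hts) (inv_le_inv.2 hms)))
    rw [ord_inv] at h₂
    have h₃ : t.ord < k := ht
    show _ < k
    omega
  revert hts
  refine ht.rec_stars (M := fun t => t ≤ s → Derivable (starsWith G k P) (t.meet m)) ?_ ?_
  · intro p hp hps
    exact derivable_of_mem (hP _ (hord p hps (hPk hp)) p hp (meet_le_left _ _))
  · intro σ hσ t htσ htk ih hts
    -- The shifted star still covers: its root member contains `m.right`, and the old cover survives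
    -- inside `m.left`.
    obtain ⟨⟨hσT, hσs⟩, f, hf⟩ : _ ∧ ∃ f : OrientedSep G → OrientedSep G,
        f t.inv = (t.meet m).inv ∧ ∀ r, r ≠ t.inv → f r = r.meet m := by
      classical
      exact ⟨hσ, fun r => if r = t.inv then (t.meet m).inv else r.meet m, by simp,
        fun r hr => by simp [hr]⟩
    obtain ⟨r, hr, rfl, hrc⟩ := mem_coverTriples.1 hσT
    have hleft : ∀ q, q.left ∩ m.left ⊆ (f q).left := by
      intro q v hv
      by_cases hq : q = t.inv
      · rw [hq, hf.1]
        have hv' := hv.1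
        rw [hq] at hv'
        exact Or.inl hv'
      · rw [hf.2 q hq]
        exact hv
    obtain ⟨i₀, hi₀⟩ := htσ
    have hright : m.right ⊆ (f (r i₀)).left := by
      rw [hi₀, hf.1]
      exact Set.subset_union_right
    have hfk : ∀ i, f (r i) ∈ sepsLT G k := by
      intro i
      by_cases hq : r i = t.inv
      · rw [hq, hf.1, inv_mem_sepsLT]
        exact hord t hts htk
      · rw [hf.2 _ hq]
        exact hord _ ((ih _ ⟨i, rfl⟩ hq).1.trans hts) (hr i)
    have hstar : Set.range (fun i => f (r i)) ∈ coverStars G k := by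
      refine ⟨mem_coverTriples.2 ⟨_, hfk, rfl, ?_, ?_⟩, ?_, ?_⟩
      · intro v
        rcases m.mem_union v with hv | hv
        · obtain ⟨i, hi⟩ := hrc.1 v
          exact ⟨i, hleft _ ⟨hi, hv⟩⟩
        · exact ⟨i₀, hright hv⟩
      · intro u v huv
        rcases m.adj_sides huv with ⟨hu, hv⟩ | ⟨hu, hv⟩
        · obtain ⟨i, hi, hi'⟩ := hrc.2 u v huv
          exact ⟨i, hleft _ ⟨hi, hu⟩, hleft _ ⟨hi', hv⟩⟩
        · exact ⟨i₀, hright hu, hright hv⟩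
      · rintro _ ⟨i, rfl⟩
        exact hnd _ (hfk i)
      · have hroot : ∀ q ∈ Set.range r, q ≠ t.inv → q.meet m ≤ (t.meet m).inv.inv :=
          fun q hq hne => meet_mono_left (ih q hq hne).1 m
        rintro _ ⟨i, rfl⟩ _ ⟨j, rfl⟩ hij
        simp only at hij ⊢
        have hij' : r i ≠ r j := fun h => hij (by rw [h])
        by_cases hi : r i = t.inv
        · have hj : r j ≠ t.inv := fun h => hij' (hi.trans h.symm)
          rw [hi, hf.1, hf.2 _ hj]
          exact le_inv_comm.1 (hroot _ ⟨j, rfl⟩ hj)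
        · by_cases hj : r j = t.inv
          · rw [hj, hf.1, hf.2 _ hi]
            exact hroot _ ⟨i, rfl⟩ hi
          · rw [hf.2 _ hi, hf.2 _ hj]
            exact (meet_le_left _ _).trans ((hσs.2 _ ⟨i, rfl⟩ _ ⟨j, rfl⟩ hij').trans
              (inv_le_inv.2 (meet_le_left _ _)))
    refine .node _ (Or.inl hstar) _ (Set.mem_range.2 ⟨i₀, by simp only [hi₀, hf.1]⟩) ?_
    rintro _ ⟨i, rfl⟩ hne
    simp only at hne ⊢
    have hi : r i ≠ t.inv := fun h => hne (by rw [h, hf.1])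
    rw [hf.2 _ hi]
    have := ih _ ⟨i, rfl⟩ hi
    exact this.2.2 (this.1.trans hts)

end Shift

/-! ### Unforced sets extend to tangles -/

section Duality

variable {V : Type u} [Finite V] {G : SimpleGraph V}

instance : Finite (OrientedSep G) :=
  Finite.of_injective (fun s : OrientedSep G => (s.left, s.right)) fun _ _ h =>
    OrientedSep.ext (congrArg Prod.fst h) (congrArg Prod.snd h)

/-- `P` is a down-closed set of separations of order less than `k`. -/
def IsDownIn (k : ℕ) (P : Set (OrientedSep G)) : Prop :=
  P ⊆ sepsLT G k ∧ ∀ r ∈ sepsLT G k, ∀ s ∈ P, r ≤ s → r ∈ P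

/-- A maximal unforced down-closed set contains an orientation of every separation. -/
lemma mem_or_inv_mem_of_maximal {k : ℕ} (hnd : ∀ s ∈ sepsLT G k, s ≠ s.inv)
    {P : Set (OrientedSep G)} (hP : Maximal (fun Q => IsDownIn k Q ∧ Unforced k Q) P)
    {s : OrientedSep G} (hs : s ∈ sepsLT G k) : s ∈ P ∨ s.inv ∈ P := by
  have hmin : ∀ q ∈ sepsLT G k, q ∉ P → q.inv ∉ P → ∃ r ≤ q, r ∈ sepsLT G k ∧ r ∉ P ∧
      r.inv ∉ P ∧ Derivable (starsWith G k P) r.inv := by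
    intro q hqk hq hq'
    -- By minimality, everything of order `< k` strictly below `r` is in `P`, so adding `r` keeps
    -- `P` down-closed and maximality makes the result forced.
    obtain ⟨r, hrq, hr⟩ := (Set.toFinite {r | r ∈ sepsLT G k ∧ r ∉ P ∧ r.inv ∉ P}).exists_le_minimal
      (a := q) ⟨hqk, hq, hq'⟩
    obtain ⟨hrk, hrP, hrP'⟩ := hr.prop
    refine ⟨r, hrq, hrk, hrP, hrP', derivable_inv_of_not_unforced hnd hrk hP.prop.2 fun hun => ?_⟩
    refine hrP (hP.le_of_ge ⟨⟨?_, ?_⟩, hun⟩ (Set.subset_insert r P) (Set.mem_insert r P))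
    · exact Set.insert_subset hrk hP.prop.1.1
    · rintro a hak b (rfl | hb) hab
      · by_contra ha
        rw [Set.mem_insert_iff, not_or] at ha
        by_cases ha' : a.inv ∈ P
        · exact hrP' (hP.prop.1.2 _ (inv_mem_sepsLT.2 hrk) _ ha' (inv_le_inv.2 hab))
        · exact ha.1 (le_antisymm hab (hr.le_of_le ⟨hak, ha.2, ha'⟩ hab))
      · exact Or.inr (hP.prop.1.2 a hak b hb hab)
  by_contra! hcon
  obtain ⟨s₁, hs₁, hs₁k, hs₁P, hs₁P', hd₁⟩ := hmin s hs hcon.1 hcon.2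
  obtain ⟨r, hr, hrk, -, -, hd₂⟩ := hmin s₁.inv (inv_mem_sepsLT.2 hs₁k) hs₁P' (by simpa using hs₁P)
  have hsr : s₁ ≤ r.inv := le_inv_comm.1 hr
  -- Minimum order in the whole interval serves both shifts: `r*` is moved down to `m`, and `s₁*` to
  -- `m*`.
  obtain ⟨m, ⟨hm₁, hm₂⟩, hm⟩ := Set.exists_min_image {q | s₁ ≤ q ∧ q ≤ r.inv} ord
    (Set.toFinite _) ⟨s₁, le_rfl, hsr⟩
  have hd₂' := hd₂.shift hnd hP.prop.1.1 hP.prop.1.2 (m := m)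
    (fun q h₁ h₂ => hm q ⟨hm₁.trans h₁, h₂⟩) hm₂ le_rfl
  have hd₁' := hd₁.shift hnd hP.prop.1.1 hP.prop.1.2 (m := m.inv)
    (fun q h₁ h₂ => by
      rw [ord_inv, ← ord_inv q]
      exact hm _ ⟨le_inv_comm.1 h₂, (inv_le_comm.1 h₁).trans hm₂⟩) (inv_le_inv.2 hm₁) le_rfl
  rw [meet_eq_right hm₂] at hd₂'
  rw [meet_eq_right (inv_le_inv.2 hm₁)] at hd₁'
  exact hP.prop.2 m ⟨hd₂', hd₁'⟩

/-- A down-closed set of separations that contains a covering triple contains a covering star. -/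
lemma exists_coverStar_subset {k : ℕ} (hnd : ∀ s ∈ sepsLT G k, s ≠ s.inv)
    {P : Set (OrientedSep G)} (hP : IsDownIn k P) {σ : Set (OrientedSep G)}
    (hσ : σ ∈ coverTriples G k) (hσP : σ ⊆ P) : ∃ τ ∈ coverStars G k, τ ⊆ P := by
  obtain ⟨r₀, -, rfl, hc₀⟩ := mem_coverTriples.1 hσ
  obtain ⟨r, -, hr⟩ := (Set.toFinite {r : Fin 3 → OrientedSep G | Set.range r ⊆ P ∧
    Covers r}).exists_le_minimal (a := r₀) ⟨hσP, hc₀⟩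
  obtain ⟨hrP, hrc⟩ := hr.prop
  rw [Set.range_subset_iff] at hrP
  -- What `r i` loses to the corner is covered by `r j`, so the new triple still covers and
  -- minimality forbids any change.
  have hstep : ∀ i j, i ≠ j → ((r i).meet (r j).inv).ord ≤ (r i).ord → r i ≤ (r j).inv := by
    intro i j hij hord
    have hmem : (r i).meet (r j).inv ∈ P :=
      hP.2 _ (lt_of_le_of_lt hord (hP.1 (hrP i))) _ (hrP i) (meet_le_left _ _)
    have hj : Function.update r i ((r i).meet (r j).inv) j = r j :=
      Function.update_of_ne hij.symm _ _
    have hi : Function.update r i ((r i).meet (r j).inv) i = (r i).meet (r j).inv :=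
      Function.update_self ..
    have hl : ∀ l, l ≠ i → Function.update r i ((r i).meet (r j).inv) l = r l :=
      fun l hl => Function.update_of_ne hl _ _
    have hle : Function.update r i ((r i).meet (r j).inv) ≤ r :=
      update_le_self_iff.2 (meet_le_left _ _)
    have hmin := hr.le_of_le ⟨?_, ?_, ?_⟩ hle i
    · rw [hi] at hmin
      exact hmin.trans (meet_le_right _ _)
    · rw [Set.range_subset_iff]
      intro l
      by_cases h : l = i
      · rw [h, hi]
        exact hmem
      · rw [hl l h]
        exact hrP l
    · intro v
      obtain ⟨l, hv⟩ := hrc.1 v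
      by_cases h : l = i
      · subst h
        rcases (r j).mem_union v with hv' | hv'
        · exact ⟨j, by rwa [hj]⟩
        · exact ⟨l, by rw [hi]; exact ⟨hv, hv'⟩⟩
      · exact ⟨l, by rwa [hl l h]⟩
    · intro u v huv
      obtain ⟨l, hu, hv⟩ := hrc.2 u v huv
      by_cases h : l = i
      · subst h
        rcases (r j).adj_sides huv with hv' | hv'
        · exact ⟨j, by rwa [hj]⟩
        · exact ⟨l, by rw [hi]; exact ⟨⟨hu, hv'.1⟩, hv, hv'.2⟩⟩
      · exact ⟨l, by rw [hl l h]; exact ⟨hu, hv⟩⟩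
  refine ⟨Set.range r, ⟨mem_coverTriples.2 ⟨r, fun i => hP.1 (hrP i), rfl, hrc⟩, ?_, ?_⟩,
    Set.range_subset_iff.2 hrP⟩
  · rintro _ ⟨i, rfl⟩
    exact hnd _ (hP.1 (hrP i))
  · rintro _ ⟨i, rfl⟩ _ ⟨j, rfl⟩ hne
    have hij : i ≠ j := fun h => hne (by rw [h])
    -- By submodularity, one of the two opposite corners has order at most that of the separation it
    -- would replace.
    have hsub := ord_meet_add_ord_meet_inv (r i) (r j).inv
    by_cases h : ((r i).meet (r j).inv).ord ≤ (r i).ord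
    · exact hstep i j hij h
    · refine le_inv_comm.1 (hstep j i hij.symm ?_)
      have : ((r i).inv.meet (r j).inv.inv).ord = ((r j).meet (r i).inv).ord := by
        simp only [meet, ord, inv_left, inv_right, Set.inter_comm, Set.union_comm]
      rw [this, ord_inv] at hsub
      omega

/-- Every unforced down-closed set of separations extends to a `k`-tangle. -/
lemma exists_isTangle_of_unforced {k : ℕ} (hnd : ∀ s ∈ sepsLT G k, s ≠ s.inv)
    {Q : Set (OrientedSep G)} (hQ : IsDownIn k Q) (hun : Unforced k Q) :
    ∃ P, Q ⊆ P ∧ IsTangle G k P := by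
  obtain ⟨P, hQP, hP⟩ := (Set.toFinite {P : Set (OrientedSep G) | IsDownIn k P ∧
    Unforced k P}).exists_le_maximal (a := Q) ⟨hQ, hun⟩
  have hnot : ∀ s ∈ P, s.inv ∉ P := fun s hs hs' =>
    hP.prop.2 s ⟨derivable_of_mem hs, derivable_of_mem hs'⟩
  refine ⟨P, hQP, ⟨hP.prop.1.1, ?_⟩, ?_, ?_⟩
  · intro s hs
    rcases mem_or_inv_mem_of_maximal hnd hP hs with h | h
    · refine ⟨s, ⟨h, Or.inl rfl⟩, ?_⟩
      rintro r ⟨hr, rfl | rfl⟩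
      · rfl
      · exact absurd hr (hnot s h)
    · refine ⟨s.inv, ⟨h, Or.inr rfl⟩, ?_⟩
      rintro r ⟨hr, rfl | rfl⟩
      · exact absurd h (hnot r hr)
      · rfl
  · rintro r s - - hrs ⟨hr, hs⟩
    exact hnot r (hP.prop.1.2 r (inv_mem_sepsLT.1 (hP.prop.1.1 hr)) s hs hrs.le) hr
  · intro σ hσ hσP
    obtain ⟨τ, hτ, hτP⟩ := exists_coverStar_subset hnd hP.prop.1 hσ hσP
    obtain ⟨r, -, rfl, -⟩ := mem_coverTriples.1 hτ.1
    refine hP.prop.2 (r 0) ⟨derivable_of_mem (hτP (Set.mem_range_self 0)), ?_⟩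
    exact .node _ (Or.inl hτ) _ (Set.mem_range_self 0) fun q hq _ => derivable_of_mem (hτP hq)

end Duality

/-! ### Trimming the leaves by following `O` -/

section Leaf

variable {V : Type u} {G : SimpleGraph V}

/-- If a tangle contains a maximal element `x`, then a tree whose leaf separations are at least `x`
only needs the leaf separation `x` itself. -/
lemma exists_derivable_pair {k : ℕ} (hnd : ∀ s ∈ sepsLT G k, s ≠ s.inv)
    {O : Set (OrientedSep G)} (hO : IsTangle G k O) {x : OrientedSep G}
    (hx : Maximal (fun y => y ∈ O) x)
    (hun : ¬ Unforced k {y | y ∈ sepsLT G k ∧ y ≤ x.inv}) :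
    ∃ t ∈ sepsLT G k, Derivable (starsWith G k {x.inv}) t ∧
      Derivable (starsWith G k {x.inv}) t.inv := by
  set P := {y | y ∈ sepsLT G k ∧ y ≤ x.inv} with hPdef
  have hor : ∀ s ∈ sepsLT G k, s ∈ O ∨ s.inv ∈ O := by
    intro s hs
    obtain ⟨r, ⟨hr, rfl | rfl⟩, -⟩ := hO.1.2 s hs
    · exact Or.inl hr
    · exact Or.inr hr
  have hA : ∀ t, Derivable (starsWith G k P) t → t ≤ x → Derivable (starsWith G k {x.inv}) t := by
    intro t ht
    refine ht.rec_stars (M := fun t => t ≤ x → Derivable (starsWith G k {x.inv}) t) ?_ ?_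
    · rintro p ⟨hp, hpx'⟩ hpx
      exact derivable_of_small hnd hp (right_eq_univ_of_le hpx hpx')
    · intro σ hσ t htσ _ ih htx
      exact .node σ (Or.inl hσ) t htσ fun r hr hne =>
        (ih r hr hne).2.2 ((ih r hr hne).1.trans htx)
  have hB : ∀ t, Derivable (starsWith G k P) t → t.inv ∈ O →
      Derivable (starsWith G k {x.inv}) t ∧ x.inv ≤ t := by
    intro t ht
    refine ht.rec_stars (M := fun t => t.inv ∈ O →
      Derivable (starsWith G k {x.inv}) t ∧ x.inv ≤ t) ?_ ?_
    · rintro p ⟨hp, hpx⟩ hpO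
      have : p = x.inv := le_antisymm hpx (inv_le_inv.1 (hx.le_of_ge hpO (le_inv_comm.1 hpx)))
      exact ⟨derivable_of_mem this, this.ge⟩
    · intro σ hσ t htσ _ ih htO
      -- As `O` includes no covering star, some `r ∈ σ` has `r* ∈ O`: the path continues along `r`.
      -- Every other branch lies below `r* ≤ x`, where `hA` applies.
      obtain ⟨r, hrσ, hrO⟩ := Set.not_subset.1 (hO.2.2 σ hσ.1)
      have hrt : r ≠ t.inv := fun h => hrO (h ▸ htO)
      have hrk : r ∈ sepsLT G k := by
        obtain ⟨q, hq, rfl, -⟩ := mem_coverTriples.1 hσ.1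
        obtain ⟨i, rfl⟩ := hrσ
        exact hq i
      obtain ⟨hrt', -, hr⟩ := ih r hrσ hrt
      obtain ⟨hdr, hxr⟩ := hr ((hor r hrk).resolve_left hrO)
      refine ⟨.node σ (Or.inl hσ) t htσ fun q hq hqt => ?_, hxr.trans hrt'⟩
      by_cases hqr : q = r
      · exact hqr ▸ hdr
      · exact hA q (ih q hq hqt).2.1
          ((hσ.2.2 q hq r hrσ hqr).trans (inv_le_comm.1 hxr))
  have hmem : ∀ t, Derivable (starsWith G k P) t → t ∈ sepsLT G k := fun t ht =>
    ht.rec_stars (M := fun t => t ∈ sepsLT G k) (fun p hp => hp.1) fun σ _ t _ ht _ => ht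
  unfold Unforced at hun
  push Not at hun
  obtain ⟨t, ht, ht'⟩ := hun
  refine ⟨t, hmem t ht, ?_⟩
  rcases hor t (hmem t ht) with h | h
  · obtain ⟨h₁, h₂⟩ := hB t.inv ht' h
    exact ⟨hA t ht (inv_le_inv.1 h₂), h₁⟩
  · obtain ⟨h₁, h₂⟩ := hB t ht h
    exact ⟨h₁, hA t.inv ht' (inv_le_comm.1 h₂)⟩

end Leaf

end OrientedSep

/-! ### Gluing trees along an edge -/

namespace SimpleGraph

/-- Joining two trees by an edge gives a tree. -/
lemma IsTree.sum_sup_edge {V W : Type*} [Finite V] [Finite W] {T : SimpleGraph V}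
    {T' : SimpleGraph W} (h : T.IsTree) (h' : T'.IsTree) (v : V) (w : W) :
    ((T ⊕g T') ⊔ edge (Sum.inl v) (Sum.inr w)).IsTree := by
  have hc := (isTree_iff_connected_and_card.1 h).2
  have hc' := (isTree_iff_connected_and_card.1 h').2
  refine isTree_iff_connected_and_card.2 ⟨h.connected.sum_sup_edge h'.connected, ?_⟩
  have hnot : s(Sum.inl v, Sum.inr w) ∉ (T ⊕g T').edgeSet := by simp
  have hins : ((T ⊕g T') ⊔ edge (Sum.inl v) (Sum.inr w)).edgeSet =
      insert s(Sum.inl v, Sum.inr w) (T ⊕g T').edgeSet := by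
    rw [edgeSet_sup, edgeSet_edge_of_ne (by simp), Set.union_comm, Set.singleton_union]
  rw [hins, Nat.card_coe_set_eq, Set.ncard_insert_of_notMem hnot, ← Nat.card_coe_set_eq,
    Nat.card_congr edgeSetSumEquiv, Nat.card_sum, Nat.card_sum]
  omega

end SimpleGraph

namespace OrientedSep

/-! ### From derivations to labelled trees -/

section RootedTree

variable {V : Type u} {G : SimpleGraph V}

/-- There is a finite labelled rooted tree whose star at the root is `ρ` and whose other stars are
all in `F`. -/
def HasRootedTree (F : Set (Set (OrientedSep G))) (ρ : Set (OrientedSep G)) : Prop :=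
  ∃ (W : Type) (_ : Finite W) (T : SimpleGraph W) (α : W → W → OrientedSep G) (root : W),
    T.IsTree ∧ (∀ a b, T.Adj a b → α b a = (α a b).inv) ∧
      {s | ∃ u, T.Adj u root ∧ α u root = s} = ρ ∧
      ∀ w, w ≠ root → {s | ∃ u, T.Adj u w ∧ α u w = s} ∈ F

lemma hasRootedTree_empty (F : Set (Set (OrientedSep G))) : HasRootedTree F ∅ := by
  refine ⟨Unit, inferInstance, ⊥, fun _ _ => ⟨Set.univ, Set.univ, by simp, by simp⟩, (),
    .of_subsingleton, ?_, ?_, ?_⟩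
  · simp
  · simp
  · intro w hw
    exact absurd rfl hw

/-- The root star need not be in `F`, so branches can be attached one at a time; the new edge
completes the star at the root of the attached branch. -/
lemma HasRootedTree.join {F : Set (Set (OrientedSep G))} {ρ ρ' : Set (OrientedSep G)}
    {s : OrientedSep G} (h : HasRootedTree F ρ) (h' : HasRootedTree F ρ')
    (hs : insert s.inv ρ' ∈ F) : HasRootedTree F (insert s ρ) := by
  obtain ⟨W, _, T, α, w₀, hT, hα, hρ, hF⟩ := h
  obtain ⟨W', _, T', α', w₀', hT', hα', hρ', hF'⟩ := h'
  let β : W ⊕ W' → W ⊕ W' → OrientedSep G := fun a b => match a, b with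
    | .inl a, .inl b => α a b
    | .inr a, .inr b => α' a b
    | .inl _, .inr _ => s.inv
    | .inr _, .inl _ => s
  have hl (a b) : ((T ⊕g T') ⊔ SimpleGraph.edge (Sum.inl w₀) (Sum.inr w₀')).Adj (.inl a) (.inl b) ↔
      T.Adj a b := by simp [SimpleGraph.edge_adj]
  have hr (a b) : ((T ⊕g T') ⊔ SimpleGraph.edge (Sum.inl w₀) (Sum.inr w₀')).Adj (.inr a) (.inr b) ↔
      T'.Adj a b := by simp [SimpleGraph.edge_adj]
  have hlr (a b) : ((T ⊕g T') ⊔ SimpleGraph.edge (Sum.inl w₀) (Sum.inr w₀')).Adj (.inl a) (.inr b) ↔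
      a = w₀ ∧ b = w₀' := by simp [SimpleGraph.edge_adj]
  have hrl (a b) : ((T ⊕g T') ⊔ SimpleGraph.edge (Sum.inl w₀) (Sum.inr w₀')).Adj (.inr a) (.inl b) ↔
      a = w₀' ∧ b = w₀ := by simp [SimpleGraph.edge_adj, and_comm]
  refine ⟨W ⊕ W', inferInstance, _, β, .inl w₀, hT.sum_sup_edge hT' w₀ w₀', ?_, ?_, ?_⟩
  · rintro (a | a) (b | b) hab
    · exact hα a b ((hl a b).1 hab)
    · exact (inv_inv s).symm
    · rfl
    · exact hα' a b ((hr a b).1 hab)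
  · ext q
    simp only [Set.mem_ofPred_eq, Sum.exists, hl, hrl, β, Set.mem_insert_iff, ← hρ]
    grind
  · rintro (w | w) hw
    · convert hF w (fun h => hw (by rw [h])) using 1
      ext q
      have : w ≠ w₀ := fun h => hw (by rw [h])
      simp only [Set.mem_ofPred_eq, Sum.exists, hl, hrl, β]
      grind
    · by_cases hw' : w = w₀'
      · convert hs using 1
        ext q
        simp only [Set.mem_ofPred_eq, Sum.exists, hr, hlr, β, Set.mem_insert_iff, ← hρ', hw']
        grind
      · convert hF' w hw' using 1
        ext q
        simp only [Set.mem_ofPred_eq, Sum.exists, hr, hlr, β]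
        grind

lemma Derivable.hasRootedTree [Finite V] {F : Set (Set (OrientedSep G))} {t : OrientedSep G}
    (h : Derivable F t) : ∃ ρ, HasRootedTree F ρ ∧ insert t.inv ρ ∈ F := by
  induction h with
  | node σ hσ t ht _ ih =>
    refine ⟨σ \ {t.inv}, ?_, by rwa [Set.insert_sdiff_singleton, Set.insert_eq_of_mem ht]⟩
    refine Set.Finite.induction_on_subset (motive := fun ρ _ => HasRootedTree F ρ) _
      (Set.toFinite _) (hasRootedTree_empty F) ?_
    intro r ρ hr _ _ hρ
    obtain ⟨ρ', hρ', hr'⟩ := ih r hr.1 hr.2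
    exact hρ.join hρ' hr'

lemma exists_isSTree [Finite V] {S : Set (OrientedSep G)} {F : Set (Set (OrientedSep G))}
    (hF : ∀ σ ∈ F, σ ⊆ S) {t : OrientedSep G} (h : Derivable F t) (h' : Derivable F t.inv) :
    ∃ (W : Type) (_ : Finite W) (T : SimpleGraph W) (α : T.Dart → OrientedSep G),
      IsSTree S F T α := by
  obtain ⟨ρ₁, hρ₁, h₁⟩ := h.hasRootedTree
  obtain ⟨ρ₂, hρ₂, h₂⟩ := h'.hasRootedTree
  rw [inv_inv] at h₂
  -- The dangling edges of the two derivations carry inverse labels and become a single edge.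
  obtain ⟨W, hW, T, α, w₀, hT, hα, hroot, hother⟩ := hρ₂.join hρ₁ h₁
  have hstar : ∀ w, {s | ∃ u, T.Adj u w ∧ α u w = s} ∈ F := by
    intro w
    by_cases hw : w = w₀
    · rw [hw, hroot]
      exact h₂
    · exact hother w hw
  refine ⟨W, hW, T, fun e => α e.fst e.snd, hT, ?_, ?_, ?_, ?_⟩
  · have : t ∈ {s | ∃ u, T.Adj u w₀ ∧ α u w₀ = s} := hroot ▸ Set.mem_insert t ρ₂
    obtain ⟨u, hu, -⟩ := this
    exact ⟨u, w₀, hu⟩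
  · exact fun e => hF _ (hstar e.snd) ⟨e.fst, e.adj, rfl⟩
  · exact fun e => hα _ _ e.adj
  · intro w
    convert hstar w using 1
    ext s
    constructor
    · rintro ⟨e, rfl, rfl⟩
      exact ⟨e.fst, e.adj, rfl⟩
    · rintro ⟨u, hu, rfl⟩
      exact ⟨⟨(u, w), hu⟩, rfl, rfl⟩

end RootedTree

end OrientedSep

theorem mainTheorem6 {V : Type*} [Finite V] (G : SimpleGraph V) (k : ℕ)
    (O : Set (OrientedSep G)) (hO : OrientedSep.IsTangle G k O)
    (x : OrientedSep G) (hx : x ∈ OrientedSep.maxInessential G k O)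
    (hnt : ¬ OrientedSep.IsTrivialIn (OrientedSep.sepsLT G k) x) :
    ∃ (W : Type) (_ : Finite W) (T : SimpleGraph W) (α : T.Dart → OrientedSep G),
      OrientedSep.IsSTree (OrientedSep.sepsLT G k)
        (OrientedSep.coverStars G k ∪ {{x}}) T α := by
  obtain ⟨hmax, hxk, hess⟩ := hx
  -- A degenerate separation in the tangle would cover `G` alone, both its sides being `V`.
  have hnd : ∀ s ∈ OrientedSep.sepsLT G k, s ≠ s.inv := by
    intro s hs hss
    have huniv : s.left = Set.univ := by
      have h : s.left = s.right := congrArg OrientedSep.left hss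
      rw [← s.union_eq, ← h, Set.union_self]
    have hsO : s ∈ O := by
      obtain ⟨r, ⟨hr, rfl | rfl⟩, -⟩ := hO.1.2 s hs
      · exact hr
      · rwa [← hss] at hr
    refine hO.2.2 {s} (OrientedSep.mem_coverTriples.2 ⟨fun _ => s, fun _ => hs, ?_, ?_, ?_⟩)
      (Set.singleton_subset_iff.2 hsO)
    · simp
    · simp [huniv]
    · simp [huniv]
  have hdown : OrientedSep.IsDownIn k {y | y ∈ OrientedSep.sepsLT G k ∧ y ≤ x.inv} :=
    ⟨fun _ hy => hy.1, fun r hr s hs hrs => ⟨hr, hrs.trans hs.2⟩⟩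
  have hforced : ¬ OrientedSep.Unforced k {y | y ∈ OrientedSep.sepsLT G k ∧ y ≤ x.inv} := by
    intro hun
    obtain ⟨P, hP, hPt⟩ := OrientedSep.exists_isTangle_of_unforced hnd hdown hun
    have hx' : x.inv ∈ P := hP ⟨OrientedSep.inv_mem_sepsLT.2 hxk, le_rfl⟩
    obtain ⟨r, -, hr⟩ := hPt.1.2 x hxk
    exact hnd x hxk ((hr x ⟨hess P hPt, Or.inl rfl⟩).trans (hr x.inv ⟨hx', Or.inr rfl⟩).symm)
  obtain ⟨t, -, ht, ht'⟩ := OrientedSep.exists_derivable_pair hnd hO hmax hforced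
  have hF : OrientedSep.starsWith G k {x.inv} = OrientedSep.coverStars G k ∪ {{x}} := by
    ext σ
    simp [OrientedSep.starsWith]
  rw [hF] at ht ht'
  refine OrientedSep.exists_isSTree ?_ ht ht'
  rintro σ (hσ | rfl)
  · obtain ⟨r, hr, rfl, -⟩ := OrientedSep.mem_coverTriples.1 hσ.1
    exact Set.range_subset_iff.2 hr
  · exact Set.singleton_subset_iff.2 hxk
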